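/- Let $n,m,p\ge 0$ and consider the quadratic program with data $\theta=(Q,q,A,b,G,h)$, $$\min_{z\in\mathbb{R}^n}\ \tfrac12 z^TQz+q^Tz\quad\text{subject to}\quad Az=b,\ Gz\le h,$$ where $Q\in\mathbb{R}^{n\times n}$ is symmetric, $q\in\mathbb{R}^n$, $A\in\mathbb{R}^{m\times n}$, $b\in\mathbb{R}^m$, $G\in\mathbb{R}^{p\times n}$, $h\in\mathbb{R}^p$. Let $\Theta$ be the set of all $\theta$ for which $Q\succ0$, $A$ has full row rank and the program is feasible. For $\theta\in\Theta$ the program has a unique solution $z^\star(\theta)$. The Clarke generalized subdifferential $\partial z^\star(\theta)$ is the convex hull of all limits $\lim_k Dz^\star(\theta_k)$, where $\theta_k\to\theta$ and each $\theta_k$ is an interior point of $\Theta$ at which $z^\star$ is differentiable. Call $\theta\in\Theta$ degenerate if the program has a primal-dual (KKT) solution $(z,\lambda,\nu)$ such that $\lambda_i=0$ and $(Gz-h)_i=0$ for some $i$. Then: 1. $\partial z^\star(\theta)\neq\varnothing$ for every $\theta\in\Theta$. 2. The set of degenerate $\theta$ has Lebesgue measure zero in the space of all data $\theta$ (with $Q$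 symmetric). 3. If $\theta\in\Theta$ is not degenerate, then $\theta$ is an interior point of $\Theta$, $z^\star$ is differentiable at $\theta$, and $\partial z^\star(\theta)=\{J\}$ where $J$ is the Jacobian of $z^\star$ at $\theta$. This Jacobian is given by the differentiated KKT system: KKT multipliers $(\lambda,\nu)$ of $z^\star=z^\star(\theta)$ exist, and for all such multipliers the matrix below is invertible and, for every differential $d\theta=(dQ,dq,dA,db,dG,dh)$ with $dQ$ symmetric, $J\,d\theta=dz$, where $$\begin{bmatrix}Q&G^T&A^T\\ D(\lambda)G&D(Gz^\star-h)&0\\ A&0&0\end{bmatrix}\begin{bmatrix}dz\\ d\lambda\\ d\nu\end{bmatrix}=\begin{bmatrix}-dQ\,z^\star-dq-dG^T\lambda-dA^T\nu\\ -D(\lambda)\,dG\,z^\star+D(\lambda)\,dh\\ -dA\,z^\star+db\end{bmatrix}$$ and $D(v)$ denotes the diagonal matrix with diagonal $v$. -/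

import Mathlib

open Set Filter Topology MeasureTheory Matrix

/-- The real vector space of symmetric `n × n` matrices (as functions of two indices). -/
def symMatrices (n : ℕ) : Submodule ℝ (Fin n → Fin n → ℝ) where
  carrier := {M | ∀ i j, M i j = M j i}
  add_mem' := by
    intro a b ha hb i j
    simp only [Pi.add_apply, ha i j, hb i j]
  zero_mem' := by
    intro i j
    rfl
  smul_mem' := by
    intro c a ha i j
    simp only [Pi.smul_apply, ha i j]

/-- The finite-dimensional real vector space of all data `θ = (Q, q, A, b, G, h)` of a quadratic
program in `n` variables with `m` equality and `p` inequality constraints, `Q` symmetric. -/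
abbrev QPData (n m p : ℕ) : Type :=
  symMatrices n × (Fin n → ℝ) × (Fin m → Fin n → ℝ) × (Fin m → ℝ) × (Fin p → Fin n → ℝ) ×
    (Fin p → ℝ)

namespace QPData

variable {n m p : ℕ}

def Q (θ : QPData n m p) : Matrix (Fin n) (Fin n) ℝ := Matrix.of θ.1.1
def q (θ : QPData n m p) : Fin n → ℝ := θ.2.1
def A (θ : QPData n m p) : Matrix (Fin m) (Fin n) ℝ := Matrix.of θ.2.2.1
def b (θ : QPData n m p) : Fin m → ℝ := θ.2.2.2.1
def G (θ : QPData n m p) : Matrix (Fin p) (Fin n) ℝ := Matrix.of θ.2.2.2.2.1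
def h (θ : QPData n m p) : Fin p → ℝ := θ.2.2.2.2.2

/-- The objective `½ zᵀ Q z + qᵀ z`. -/
noncomputable def objective (θ : QPData n m p) (z : Fin n → ℝ) : ℝ :=
  (1 / 2) * (z ⬝ᵥ (θ.Q *ᵥ z)) + θ.q ⬝ᵥ z

/-- The feasible set `{z | A z = b, G z ≤ h}` (the order is coordinatewise). -/
def feasibleSet (θ : QPData n m p) : Set (Fin n → ℝ) :=
  {z | θ.A *ᵥ z = θ.b ∧ θ.G *ᵥ z ≤ θ.h}

/-- `z` is an optimal solution of the quadratic program. -/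
def IsSolution (θ : QPData n m p) (z : Fin n → ℝ) : Prop :=
  z ∈ θ.feasibleSet ∧ ∀ w ∈ θ.feasibleSet, θ.objective z ≤ θ.objective w

/-- The solution map `z⋆(θ)`: an optimal solution, whenever there is one. -/
noncomputable def zStar (θ : QPData n m p) : Fin n → ℝ :=
  Classical.epsilon fun z => θ.IsSolution z

/-- The data for which `Q ≻ 0`, `A` has full row rank and the program is feasible. -/
def admissible (n m p : ℕ) : Set (QPData n m p) :=
  {θ | θ.Q.PosDef ∧ θ.A.rank = m ∧ θ.feasibleSet.Nonempty}

/-- The KKT conditions at `(z, lam, nu)`; `lam` and `nu` are the multipliers of the inequality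
and of the equality constraints. -/
def IsKKT (θ : QPData n m p) (z : Fin n → ℝ) (lam : Fin p → ℝ) (nu : Fin m → ℝ) : Prop :=
  θ.Q *ᵥ z + θ.q + θ.Aᵀ *ᵥ nu + θ.Gᵀ *ᵥ lam = 0 ∧
  θ.A *ᵥ z = θ.b ∧ θ.G *ᵥ z ≤ θ.h ∧ 0 ≤ lam ∧
  Matrix.diagonal lam *ᵥ (θ.G *ᵥ z - θ.h) = 0

/-- The admissible data whose program has a primal-dual solution that is not strictly
complementary: some inequality constraint is tight and its multiplier vanishes. -/
def degenerate (n m p : ℕ) : Set (QPData n m p) :=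
  {θ | θ ∈ admissible n m p ∧ ∃ z lam nu, θ.IsKKT z lam nu ∧
    ∃ i, lam i = 0 ∧ (θ.G *ᵥ z - θ.h) i = 0}

/-- The matrix of the differentiated KKT system, with rows and columns ordered `(z, lam, nu)`:
`[Q, Gᵀ, Aᵀ; D(lam) G, D(G z - h), 0; A, 0, 0]`. -/
def kktMatrix (θ : QPData n m p) (z : Fin n → ℝ) (lam : Fin p → ℝ) :
    Matrix (Fin n ⊕ (Fin p ⊕ Fin m)) (Fin n ⊕ (Fin p ⊕ Fin m)) ℝ :=
  Matrix.fromBlocks θ.Q (Matrix.fromCols θ.Gᵀ θ.Aᵀ)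
    (Matrix.fromRows (Matrix.diagonal lam * θ.G) θ.A)
    (Matrix.fromBlocks (Matrix.diagonal (θ.G *ᵥ z - θ.h)) 0 0 0)

/-- The right-hand side of the differentiated KKT system for the differential
`d = (dQ, dq, dA, db, dG, dh)` of the data. -/
def kktRhs (z : Fin n → ℝ) (lam : Fin p → ℝ) (nu : Fin m → ℝ) (d : QPData n m p) :
    Fin n ⊕ (Fin p ⊕ Fin m) → ℝ :=
  Sum.elim (-(d.Q *ᵥ z) - d.q - d.Gᵀ *ᵥ lam - d.Aᵀ *ᵥ nu)
    (Sum.elim (-(Matrix.diagonal lam *ᵥ (d.G *ᵥ z)) + Matrix.diagonal lam *ᵥ d.h)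
      (-(d.A *ᵥ z) + d.b))

end QPData

/-- The Clarke generalized subdifferential (generalized Jacobian) at `x` of a map `f` with domain
`U`: the convex hull of all limits of Jacobians `Df(xₖ)`, where the `xₖ` tend to `x` and are points
of differentiability of `f`. As a derivative at `xₖ` needs `f` to be defined around `xₖ`, the `xₖ`
are interior points of the domain. -/
def clarkeSubdifferential {E F : Type*} [NormedAddCommGroup E] [NormedSpace ℝ E]
    [NormedAddCommGroup F] [NormedSpace ℝ F] (U : Set E) (f : E → F) (x : E) :
    Set (E →L[ℝ] F) :=
  convexHull ℝ {J | ∃ u : ℕ → E, (∀ k, u k ∈ interior U ∧ DifferentiableAt ℝ f (u k)) ∧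
    Tendsto u atTop (𝓝 x) ∧ Tendsto (fun k => fderiv ℝ f (u k)) atTop (𝓝 J)}

/-! The constraints are affine, so Farkas' lemma yields KKT multipliers at the minimiser without a
constraint qualification. Once it is fixed which constraints are tight, the KKT conditions become
linear equations in `(z, lam, nu)`. They are encoded by `kktSystem μ σ`: a row with `μ i ≠ 0`, `σ i
= 0` enforces tightness, a row with `μ i = 0`, `σ i ≠ 0` annihilates the multiplier. Only the zero
pattern of the weights matters, and `lam`, `G z - h` are one choice. The matrix is invertible when
`Q ≻ 0` and the enforced gradients are independent (`IndependentGradients.det_ne_zero`).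

Under strict complementarity all inequalities left over are strict, so the solution of the linear
system remains a KKT point for nearby data. Hence `zStar` is C¹ there, with the derivative of the
linear system (`IsKKT.eventually_zStar_eq`, `IsKKT.hasFDerivAt_zStar`). Nondegenerate data fall
under this case: dependent gradients would allow a multiplier of a tight constraint to be driven to
zero, which is degeneracy.

For arbitrary admissible data, multipliers with independent gradients still exist. Relaxing the
constraints with zero multiplier keeps the KKT point and makes it strictly complementary, with the
same Jacobian for every amount of relaxation; this Jacobian is an element of the subdifferential.
Degenerate data satisfy `h i = (G z) i` for a candidate `z` computed without `h i`, for one of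
finitely many index patterns, and each such set is null. -/

/-- **Farkas' lemma** for finitely many linear functionals, without topology. -/
theorem LinearMap.exists_nonneg_combination_of_forall_nonpos {ι V : Type*} [AddCommGroup V]
    [Module ℝ V] (s : Finset ι) (a : ι → V →ₗ[ℝ] ℝ) (c : V →ₗ[ℝ] ℝ)
    (hc : ∀ x, (∀ i ∈ s, a i x ≤ 0) → c x ≤ 0) :
    ∃ w : ι → ℝ, 0 ≤ w ∧ c = ∑ i ∈ s, w i • a i := by
  classical
  induction s using Finset.induction_on generalizing a c with
  | empty =>
    refine ⟨0, le_rfl, ?_⟩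
    ext x
    have h1 := hc x (by simp)
    have h2 := hc (-x) (by simp)
    rw [map_neg] at h2
    simp only [Finset.sum_empty, LinearMap.zero_apply]
    linarith
  | insert k s hk ih =>
    by_cases h : ∀ x, (∀ i ∈ s, a i x ≤ 0) → c x ≤ 0
    · obtain ⟨w, hw, hcw⟩ := ih a c h
      refine ⟨Function.update w k 0, fun i => ?_, ?_⟩
      · by_cases hik : i = k
        · simp [hik]
        · simpa [hik] using hw i
      · rw [Finset.sum_insert hk, hcw]
        simp only [Function.update_self, zero_smul, zero_add]
        refine Finset.sum_congr rfl fun i hi => ?_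
        rw [Function.update_of_ne (by rintro rfl; exact hk hi)]
    · push Not at h
      obtain ⟨y, hy, hcy⟩ := h
      have hky : 0 < a k y := by
        by_contra hneg
        push Not at hneg
        refine absurd (hc y fun i hi => ?_) (not_le.mpr hcy)
        rcases Finset.mem_insert.mp hi with rfl | hi
        · exact hneg
        · exact hy i hi
      -- The new functionals are the old ones composed with the projection along `y` onto the kernel
      -- of `a k`, where the constraint `k` holds with equality.
      obtain ⟨w, hw, hcw⟩ := ih (fun i => a i - (a i y / a k y) • a k)
        (c - (c y / a k y) • a k) (by
          intro x hx
          have := hc (x - (a k x / a k y) • y) (by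
            intro i hi
            rcases Finset.mem_insert.mp hi with rfl | hi
            · simp [hky.ne']
            · have := hx i hi
              simp only [LinearMap.sub_apply, LinearMap.smul_apply, smul_eq_mul, map_sub,
                map_smul] at this ⊢
              convert this using 2
              ring)
          simp only [LinearMap.sub_apply, LinearMap.smul_apply, smul_eq_mul, map_sub,
            map_smul] at this ⊢
          convert this using 2
          ring)
      -- Expanding the projected identity leaves this coefficient on `a k`; it is positive since `c
      -- y > 0`, `a k y > 0` and every other `a i y ≤ 0`.
      refine ⟨Function.update w k (c y / a k y - ∑ i ∈ s, w i * (a i y / a k y)), fun i => ?_, ?_⟩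
      · by_cases hik : i = k
        · subst hik
          have : ∑ j ∈ s, w j * (a j y / a i y) ≤ 0 := Finset.sum_nonpos fun j hj =>
            mul_nonpos_of_nonneg_of_nonpos (hw j) (div_nonpos_of_nonpos_of_nonneg (hy j hj) hky.le)
          have : 0 < c y / a i y := div_pos hcy hky
          simp only [Function.update_self, Pi.zero_apply]
          linarith
        · simpa [hik] using hw i
      · rw [Finset.sum_insert hk]
        have h1 : ∑ i ∈ s, Function.update w k
            (c y / a k y - ∑ i ∈ s, w i * (a i y / a k y)) i • a i = ∑ i ∈ s, w i • a i := by
          refine Finset.sum_congr rfl fun i hi => ?_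
          rw [Function.update_of_ne (by rintro rfl; exact hk hi)]
        rw [h1, Function.update_self]
        ext x
        have h2 := LinearMap.congr_fun hcw x
        simp only [LinearMap.sub_apply, LinearMap.smul_apply, smul_eq_mul,
          LinearMap.sum_apply, LinearMap.add_apply, mul_sub, Finset.sum_sub_distrib] at h2 ⊢
        rw [sub_mul, Finset.sum_mul]
        simp only [mul_assoc] at h2 ⊢
        linarith

/-- Moving along `d` from a nonnegative vector whose support contains that of `d ≠ 0`, one reaches
a nonnegative vector of strictly smaller support. -/
theorem exists_nonneg_add_smul_of_support_subset {ι : Type*} [Fintype ι] {l d : ι → ℝ}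
    (hl : 0 ≤ l) (hd : d ≠ 0) (hs : ∀ i, l i = 0 → d i = 0) :
    ∃ t : ℝ, 0 ≤ l + t • d ∧ ∃ i, 0 < l i ∧ (l + t • d) i = 0 := by
  classical
  wlog hpos : ∃ i, d i < 0 generalizing d
  · obtain ⟨i, hi⟩ : ∃ i, d i ≠ 0 := Function.ne_iff.mp hd
    push Not at hpos
    obtain ⟨t, h1, h2⟩ := this (d := -d) (neg_ne_zero.mpr hd) (fun i hi => by simp [hs i hi])
      ⟨i, by simpa using lt_of_le_of_ne (hpos i) (Ne.symm hi)⟩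
    rw [smul_neg, ← neg_smul] at h1 h2
    exact ⟨-t, h1, h2⟩
  -- Ratio test: the least ratio belongs to the coordinate that reaches zero first.
  obtain ⟨i, hi, hmin⟩ := Finset.exists_min_image (Finset.univ.filter fun i => d i < 0)
    (fun i => l i / -d i) (by obtain ⟨i, hi⟩ := hpos; exact ⟨i, by simpa using hi⟩)
  simp only [Finset.mem_filter, Finset.mem_univ, true_and] at hi hmin
  have hli : 0 < l i := lt_of_le_of_ne (hl i) fun h => hi.ne (hs i h.symm)
  refine ⟨l i / -d i, fun j => ?_, i, hli, ?_⟩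
  · simp only [Pi.zero_apply, Pi.add_apply, Pi.smul_apply, smul_eq_mul]
    rcases lt_or_ge (d j) 0 with hj | hj
    · have := hmin j hj
      rw [le_div_iff₀ (by linarith)] at this
      linarith
    · have : 0 ≤ l i / -d i := div_nonneg hli.le (by linarith)
      have := hl j
      simp only [Pi.zero_apply] at this
      positivity
  · simp only [Pi.add_apply, Pi.smul_apply, smul_eq_mul]
    rw [div_neg, neg_mul, div_mul_cancel₀ _ hi.ne]
    ring

/-! ### Existence and uniqueness of the minimiser. -/

namespace QPData

variable {n m p : ℕ}

theorem Q_symm (θ : QPData n m p) : θ.Qᵀ = θ.Q := by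
  ext i j
  exact θ.1.2 j i

theorem posDef_iff (θ : QPData n m p) : θ.Q.PosDef ↔ ∀ x, x ≠ 0 → 0 < x ⬝ᵥ (θ.Q *ᵥ x) := by
  rw [Matrix.posDef_iff_dotProduct_mulVec]
  simp only [star_trivial]
  refine ⟨fun h => h.2, fun h => ⟨?_, h⟩⟩
  rw [Matrix.IsHermitian, Matrix.conjTranspose_eq_transpose_of_trivial, Q_symm]

theorem dotProduct_Q_mulVec_comm (θ : QPData n m p) (x y : Fin n → ℝ) :
    x ⬝ᵥ (θ.Q *ᵥ y) = y ⬝ᵥ (θ.Q *ᵥ x) := by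
  rw [Matrix.dotProduct_mulVec, ← Matrix.mulVec_transpose, Q_symm, dotProduct_comm]

theorem dotProduct_Q_nonneg {θ : QPData n m p} (hQ : θ.Q.PosDef) (x : Fin n → ℝ) :
    0 ≤ x ⬝ᵥ (θ.Q *ᵥ x) := by
  by_cases hx : x = 0
  · simp [hx]
  · exact ((posDef_iff θ).mp hQ x hx).le

theorem eq_zero_of_transpose_mulVec_eq_zero {θ : QPData n m p} (hA : θ.A.rank = m)
    {v : Fin m → ℝ} (hv : θ.Aᵀ *ᵥ v = 0) : v = 0 := by
  have h1 : LinearIndependent ℝ θ.A.row := by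
    rw [← Matrix.rank_transpose] at hA
    rw [linearIndependent_iff_card_eq_finrank_span, Set.finrank, ← Matrix.col_transpose,
      ← Matrix.rank_eq_finrank_span_cols, hA, Fintype.card_fin]
  have h2 := Matrix.vecMul_injective_iff.mpr h1
  apply h2
  simpa [Matrix.mulVec_transpose] using hv

theorem rank_eq_of_transpose_mulVec_eq_zero {θ : QPData n m p}
    (h : ∀ v, θ.Aᵀ *ᵥ v = 0 → v = 0) : θ.A.rank = m := by
  have h1 : LinearIndependent ℝ θ.A.row := by
    rw [← Matrix.vecMul_injective_iff]
    intro x y hxy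
    simp only [← Matrix.mulVec_transpose] at hxy
    exact sub_eq_zero.mp (h _ (by rw [Matrix.mulVec_sub]; exact sub_eq_zero.mpr hxy))
  simpa using h1.rank_matrix

theorem objective_add (θ : QPData n m p) (z d : Fin n → ℝ) :
    θ.objective (z + d) =
      θ.objective z + (θ.Q *ᵥ z + θ.q) ⬝ᵥ d + (1 / 2) * (d ⬝ᵥ (θ.Q *ᵥ d)) := by
  have := dotProduct_Q_mulVec_comm θ z d
  have h2 := dotProduct_comm (θ.Q *ᵥ z) d
  simp only [objective, Matrix.mulVec_add, add_dotProduct, dotProduct_add]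
  linarith

theorem feasibleSet_convex (θ : QPData n m p) {z w : Fin n → ℝ} (hz : z ∈ θ.feasibleSet)
    (hw : w ∈ θ.feasibleSet) {t : ℝ} (h0 : 0 ≤ t) (h1 : t ≤ 1) :
    z + t • (w - z) ∈ θ.feasibleSet := by
  refine ⟨?_, fun i => ?_⟩
  · rw [Matrix.mulVec_add, Matrix.mulVec_smul, Matrix.mulVec_sub, hz.1, hw.1]
    simp
  · have e1 := hz.2 i
    have e2 := hw.2 i
    simp only [Matrix.mulVec_add, Matrix.mulVec_smul, Matrix.mulVec_sub, Pi.add_apply,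
      Pi.smul_apply, Pi.sub_apply, smul_eq_mul]
    nlinarith

/-- First-order optimality along a feasible segment. -/
theorem IsSolution.nonneg_of_forall_small {θ : QPData n m p} {z d : Fin n → ℝ}
    (hz : θ.IsSolution z) {ε : ℝ} (hε : 0 < ε)
    (hd : ∀ t : ℝ, 0 < t → t < ε → z + t • d ∈ θ.feasibleSet) :
    0 ≤ (θ.Q *ᵥ z + θ.q) ⬝ᵥ d := by
  have key : ∀ᶠ t : ℝ in 𝓝[>] 0,
      0 ≤ (θ.Q *ᵥ z + θ.q) ⬝ᵥ d + t * ((1 / 2) * (d ⬝ᵥ (θ.Q *ᵥ d))) := by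
    filter_upwards [Ioo_mem_nhdsGT hε] with t ht
    have := hz.2 _ (hd t ht.1 ht.2)
    rw [objective_add, dotProduct_smul, Matrix.mulVec_smul, dotProduct_smul, smul_dotProduct] at this
    simp only [smul_eq_mul] at this
    have h3 : 0 ≤ t * ((θ.Q *ᵥ z + θ.q) ⬝ᵥ d + t * ((1 / 2) * (d ⬝ᵥ (θ.Q *ᵥ d)))) := by linarith
    exact nonneg_of_mul_nonneg_right h3 ht.1
  have hlim : Tendsto (fun t : ℝ => (θ.Q *ᵥ z + θ.q) ⬝ᵥ d + t * ((1 / 2) * (d ⬝ᵥ (θ.Q *ᵥ d))))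
      (𝓝[>] 0) (𝓝 ((θ.Q *ᵥ z + θ.q) ⬝ᵥ d)) := by
    refine Tendsto.mono_left ?_ nhdsWithin_le_nhds
    have : Continuous fun t : ℝ =>
        (θ.Q *ᵥ z + θ.q) ⬝ᵥ d + t * ((1 / 2) * (d ⬝ᵥ (θ.Q *ᵥ d))) := by fun_prop
    simpa using this.tendsto 0
  exact ge_of_tendsto hlim key

theorem IsSolution.unique {θ : QPData n m p} (hQ : θ.Q.PosDef) {z w : Fin n → ℝ}
    (hz : θ.IsSolution z) (hw : θ.IsSolution w) : w = z := by
  by_contra hne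
  have h1 := hz.nonneg_of_forall_small one_pos fun t h0 ht =>
    feasibleSet_convex θ hz.1 hw.1 h0.le ht.le
  have h2 := objective_add θ z (w - z)
  have h3 := (posDef_iff θ).mp hQ (w - z) (sub_ne_zero.mpr hne)
  have h4 := hw.2 z hz.1
  rw [add_sub_cancel] at h2
  linarith

theorem exists_pos_mul_sq_le {θ : QPData n m p} (hQ : θ.Q.PosDef) :
    ∃ c : ℝ, 0 < c ∧ ∀ x, c * ‖x‖ ^ 2 ≤ x ⬝ᵥ (θ.Q *ᵥ x) := by
  have h : ∀ᶠ c : ℝ in 𝓝 0, ∀ x ∈ Metric.sphere (0 : Fin n → ℝ) 1, c < x ⬝ᵥ (θ.Q *ᵥ x) := by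
    refine (isCompact_sphere _ _).eventually_forall_of_forall_eventually fun x hx => ?_
    have hx0 : x ≠ 0 := by
      rintro rfl
      simp at hx
    refine ContinuousAt.eventually_lt (f := fun z : ℝ × (Fin n → ℝ) => z.1)
      (g := fun z => z.2 ⬝ᵥ (θ.Q *ᵥ z.2)) (by fun_prop) (by fun_prop) ?_
    exact (posDef_iff θ).mp hQ x hx0
  obtain ⟨c, hc, hpos⟩ := ((h.filter_mono nhdsWithin_le_nhds).and
    (self_mem_nhdsWithin : Ioi (0 : ℝ) ∈ 𝓝[>] 0)).exists
  refine ⟨c, hpos, fun x => ?_⟩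
  by_cases hx : x = 0
  · simp [hx]
  have hn : 0 < ‖x‖ := norm_pos_iff.mpr hx
  have := hc (‖x‖⁻¹ • x) (by simp [norm_smul, hn.ne'])
  rw [Matrix.mulVec_smul, dotProduct_smul, smul_dotProduct] at this
  simp only [smul_eq_mul] at this
  have h2 : x ⬝ᵥ (θ.Q *ᵥ x) = ‖x‖ ^ 2 * (‖x‖⁻¹ * (‖x‖⁻¹ * x ⬝ᵥ (θ.Q *ᵥ x))) := by
    field_simp
  rw [h2, mul_comm]
  exact mul_le_mul_of_nonneg_left this.le (by positivity)

theorem exists_isSolution {θ : QPData n m p} (hθ : θ ∈ admissible n m p) :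
    ∃ z, θ.IsSolution z := by
  obtain ⟨hQ, -, z₀, hz₀⟩ := hθ
  obtain ⟨c, hc, hcx⟩ := exists_pos_mul_sq_le hQ
  have hcont : Continuous θ.objective := by
    unfold objective
    fun_prop
  have hclosed : IsClosed θ.feasibleSet :=
    (isClosed_eq (f := fun z => θ.A *ᵥ z) (by fun_prop) continuous_const).inter
      (isClosed_le (f := fun z => θ.G *ᵥ z) (by fun_prop) continuous_const)
  have hlow : ∀ x, c / 2 * ‖x‖ ^ 2 - (∑ i, |θ.q i|) * ‖x‖ ≤ θ.objective x := by
    intro x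
    have h1 : -(θ.q ⬝ᵥ x) ≤ (∑ i, |θ.q i|) * ‖x‖ := by
      rw [Finset.sum_mul, dotProduct, ← Finset.sum_neg_distrib]
      refine Finset.sum_le_sum fun i _ => ?_
      calc -(θ.q i * x i) ≤ |θ.q i * x i| := neg_le_abs _
        _ = |θ.q i| * ‖x i‖ := by rw [abs_mul, Real.norm_eq_abs]
        _ ≤ _ := mul_le_mul_of_nonneg_left (norm_le_pi_norm x i) (abs_nonneg _)
    have h2 := hcx x
    unfold objective
    linarith
  have hev : ∀ᶠ x in cocompact (Fin n → ℝ) ⊓ 𝓟 θ.feasibleSet, θ.objective z₀ ≤ θ.objective x := by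
    refine Filter.Eventually.filter_mono inf_le_left ?_
    set K := ∑ i, |θ.q i|
    have hK : 0 ≤ K := Finset.sum_nonneg fun i _ => abs_nonneg _
    -- The second bound gives `c / 2 * ‖x‖ - K ≥ |θ.objective z₀|`; multiplying by `‖x‖ ≥ 1` puts
    -- the lower bound `hlow` above the value at `z₀`.
    filter_upwards [tendsto_norm_cocompact_atTop.eventually_ge_atTop
      (max 1 (2 / c * (|θ.objective z₀| + K)))] with x hx
    refine le_trans ?_ (hlow x)
    have h1 : 1 ≤ ‖x‖ := le_trans (le_max_left _ _) hx
    have h2 : 2 / c * (|θ.objective z₀| + K) ≤ ‖x‖ := le_trans (le_max_right _ _) hx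
    have h3 : |θ.objective z₀| + K ≤ c / 2 * ‖x‖ := by
      rw [div_mul_eq_mul_div, div_le_iff₀ hc] at h2
      linarith
    have h4 := le_abs_self (θ.objective z₀)
    have h5 := abs_nonneg (θ.objective z₀)
    nlinarith
  obtain ⟨z, hz, hmin⟩ := hcont.continuousOn.exists_isMinOn' hclosed hz₀ hev
  exact ⟨z, hz, fun w hw => hmin hw⟩

theorem isSolution_zStar {θ : QPData n m p} (hθ : θ ∈ admissible n m p) :
    θ.IsSolution θ.zStar :=
  Classical.epsilon_spec (exists_isSolution hθ)

/-! ### Equivalence of optimality and the KKT conditions. -/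

theorem IsKKT.complementary {θ : QPData n m p} {z : Fin n → ℝ} {lam : Fin p → ℝ} {nu : Fin m → ℝ}
    (h : θ.IsKKT z lam nu) (i : Fin p) : lam i * ((θ.G *ᵥ z) i - θ.h i) = 0 := by
  have := congrFun h.2.2.2.2 i
  rwa [Matrix.mulVec_diagonal] at this

theorem IsKKT.isSolution {θ : QPData n m p} (hQ : θ.Q.PosDef) {z : Fin n → ℝ} {lam : Fin p → ℝ}
    {nu : Fin m → ℝ} (h : θ.IsKKT z lam nu) : θ.IsSolution z := by
  refine ⟨⟨h.2.1, h.2.2.1⟩, fun w hw => ?_⟩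
  have e := objective_add θ z (w - z)
  rw [add_sub_cancel] at e
  have h1 := dotProduct_Q_nonneg hQ (w - z)
  have h2 : θ.Q *ᵥ z + θ.q = -(θ.Aᵀ *ᵥ nu + θ.Gᵀ *ᵥ lam) :=
    eq_neg_of_add_eq_zero_left (by rw [← add_assoc]; exact h.1)
  have h3 : (θ.Aᵀ *ᵥ nu) ⬝ᵥ (w - z) = 0 := by
    rw [Matrix.mulVec_transpose, ← Matrix.dotProduct_mulVec, Matrix.mulVec_sub, hw.1, h.2.1,
      sub_self, dotProduct_zero]
  have h4 : (θ.Gᵀ *ᵥ lam) ⬝ᵥ (w - z) ≤ 0 := by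
    rw [Matrix.mulVec_transpose, ← Matrix.dotProduct_mulVec, Matrix.mulVec_sub]
    refine Finset.sum_nonpos fun i _ => ?_
    have c := h.complementary i
    have := mul_nonneg (h.2.2.2.1 i) (sub_nonneg.mpr (hw.2 i))
    simp only [Pi.sub_apply]
    linarith
  rw [h2, neg_dotProduct, add_dotProduct] at e
  linarith

theorem IsKKT.zStar_eq {θ : QPData n m p} (hθ : θ ∈ admissible n m p) {z : Fin n → ℝ}
    {lam : Fin p → ℝ} {nu : Fin m → ℝ} (h : θ.IsKKT z lam nu) : θ.zStar = z :=
  (h.isSolution hθ.1).unique hθ.1 (isSolution_zStar hθ)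

/-- A direction that respects the tight constraints to first order stays feasible for small steps,
because the constraints are affine and the slack ones have room. The objective therefore cannot
decrease along it, and Farkas' lemma turns this into multipliers. -/
theorem IsSolution.exists_isKKT {θ : QPData n m p} {z : Fin n → ℝ} (hz : θ.IsSolution z) :
    ∃ lam nu, θ.IsKKT z lam nu := by
  classical
  -- Slack inequalities contribute the zero functional. Each equality occurs with both signs, so
  -- that the difference of two nonnegative weights is a free multiplier.
  let a : Fin p ⊕ (Fin m ⊕ Fin m) → (Fin n → ℝ) →ₗ[ℝ] ℝ := Sum.elim
    (fun i => if (θ.G *ᵥ z) i = θ.h i then (LinearMap.proj i).comp θ.G.mulVecLin else 0)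
    (Sum.elim (fun j => (LinearMap.proj j).comp θ.A.mulVecLin)
      fun j => -(LinearMap.proj j).comp θ.A.mulVecLin)
  obtain ⟨w, hw, hcw⟩ := LinearMap.exists_nonneg_combination_of_forall_nonpos Finset.univ a
    (-(dotProductBilin ℝ ℝ (θ.Q *ᵥ z + θ.q))) (by
      intro d hd
      have hA : θ.A *ᵥ d = 0 := by
        ext j
        have h1 := hd (Sum.inr (Sum.inl j)) (Finset.mem_univ _)
        have h2 := hd (Sum.inr (Sum.inr j)) (Finset.mem_univ _)
        simp [a] at h1 h2
        exact le_antisymm h1 h2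
      have hG : ∀ i, (θ.G *ᵥ z) i = θ.h i → (θ.G *ᵥ d) i ≤ 0 := by
        intro i hi
        have h1 := hd (Sum.inl i) (Finset.mem_univ _)
        simpa [a, hi] using h1
      have hev : ∀ᶠ t : ℝ in 𝓝[>] 0, z + t • d ∈ θ.feasibleSet := by
        have : ∀ᶠ t : ℝ in 𝓝[>] 0, ∀ i, (θ.G *ᵥ z) i + t * (θ.G *ᵥ d) i ≤ θ.h i := by
          rw [eventually_all]
          intro i
          rcases (hz.1.2 i).eq_or_lt with hi | hi
          · filter_upwards [self_mem_nhdsWithin] with t (ht : 0 < t)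
            have := mul_nonpos_of_nonneg_of_nonpos ht.le (hG i hi)
            linarith
          · refine Filter.Eventually.filter_mono nhdsWithin_le_nhds ?_
            have : ContinuousAt (fun t : ℝ => (θ.G *ᵥ z) i + t * (θ.G *ᵥ d) i) 0 := by fun_prop
            exact (this.eventually_lt continuousAt_const (by simpa using hi)).mono
              fun t ht => ht.le
        filter_upwards [this] with t ht
        refine ⟨by rw [Matrix.mulVec_add, Matrix.mulVec_smul, hA, hz.1.1]; simp, fun i => ?_⟩
        simpa [Matrix.mulVec_add, Matrix.mulVec_smul] using ht i
      obtain ⟨ε, hε, hsub⟩ := (mem_nhdsGT_iff_exists_Ioo_subset).mp hev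
      have := hz.nonneg_of_forall_small (Set.mem_Ioi.mp hε) fun t h0 ht => hsub ⟨h0, ht⟩
      rw [LinearMap.neg_apply, dotProductBilin_apply_apply]
      exact neg_nonpos.mpr this)
  refine ⟨fun i => if (θ.G *ᵥ z) i = θ.h i then w (Sum.inl i) else 0,
    fun j => w (Sum.inr (Sum.inl j)) - w (Sum.inr (Sum.inr j)), ?_, hz.1.1, hz.1.2, ?_, ?_⟩
  · ext k
    have := LinearMap.congr_fun hcw (Pi.single k 1)
    simp only [LinearMap.neg_apply, dotProductBilin_apply_apply, dotProduct_single_one,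
      Fintype.sum_sum_type, LinearMap.add_apply, LinearMap.sum_apply, LinearMap.smul_apply,
      smul_eq_mul, a, Sum.elim_inl, Sum.elim_inr, LinearMap.comp_apply, LinearMap.proj_apply,
      Matrix.mulVecLin_apply, Matrix.mulVec_single_one, Matrix.col_apply] at this
    simp only [Pi.add_apply, Matrix.mulVec, dotProduct, Matrix.transpose_apply, Pi.zero_apply,
      mul_sub, Finset.sum_sub_distrib] at this ⊢
    have h1 : ∀ i, w (Sum.inl i) * (if ∑ j, θ.G i j * z j = θ.h i then
        (LinearMap.proj i).comp θ.G.mulVecLin else (0 : (Fin n → ℝ) →ₗ[ℝ] ℝ)) (Pi.single k 1) =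
        θ.G i k * (if ∑ j, θ.G i j * z j = θ.h i then w (Sum.inl i) else 0) := by
      intro i
      split_ifs
      · simp [mul_comm]
      · simp
    simp only [h1, mul_comm (w _) _, neg_mul, Finset.sum_neg_distrib] at this
    linarith
  · intro i
    simp only [Pi.zero_apply]
    split_ifs
    · exact hw _
    · exact le_rfl
  · ext i
    rw [Matrix.mulVec_diagonal]
    simp only [Pi.sub_apply, Pi.zero_apply]
    split_ifs with hi
    · simp [hi]
    · simp

end QPData

/-! ### Smoothness of the determinant and the matrix inverse. -/

theorem contDiffAt_det {E ι : Type*} [NormedAddCommGroup E] [NormedSpace ℝ E] [Fintype ι]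
    [DecidableEq ι] {k : WithTop ℕ∞} {M : E → Matrix ι ι ℝ} {x : E}
    (hM : ∀ i j, ContDiffAt ℝ k (fun y => M y i j) x) : ContDiffAt ℝ k (fun y => (M y).det) x := by
  simp only [Matrix.det_apply]
  exact ContDiffAt.sum fun s _ => (contDiffAt_prod fun i _ => hM _ _).const_smul _

theorem contDiffAt_matrix_inv {E ι : Type*} [NormedAddCommGroup E] [NormedSpace ℝ E] [Fintype ι]
    [DecidableEq ι] {k : WithTop ℕ∞} {M : E → Matrix ι ι ℝ} {x : E}
    (hM : ∀ i j, ContDiffAt ℝ k (fun y => M y i j) x) (hdet : (M x).det ≠ 0) (i j : ι) :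
    ContDiffAt ℝ k (fun y => (M y)⁻¹ i j) x := by
  simp only [Matrix.inv_def, Ring.inverse_eq_inv, Matrix.smul_apply, smul_eq_mul,
    Matrix.adjugate_apply]
  refine ((contDiffAt_det hM).inv hdet).mul (contDiffAt_det fun a b => ?_)
  by_cases ha : a = j
  · subst ha
    simp only [Matrix.updateRow_self]
    exact contDiffAt_const
  · simp only [Matrix.updateRow_ne ha]
    exact hM a b

/-! ### The weighted KKT system and the local form of the solution map. -/

namespace QPData

variable {n m p : ℕ}

/-- The matrix `[Q, Gᵀ, Aᵀ; D(μ) G, D(σ), 0; A, 0, 0]`. -/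
def kktSystem (θ : QPData n m p) (μ σ : Fin p → ℝ) :
    Matrix (Fin n ⊕ (Fin p ⊕ Fin m)) (Fin n ⊕ (Fin p ⊕ Fin m)) ℝ :=
  Matrix.fromBlocks θ.Q (Matrix.fromCols θ.Gᵀ θ.Aᵀ)
    (Matrix.fromRows (Matrix.diagonal μ * θ.G) θ.A)
    (Matrix.fromBlocks (Matrix.diagonal σ) 0 0 0)

theorem kktSystem_mulVec (θ : QPData n m p) (μ σ : Fin p → ℝ) (y : Fin n → ℝ) (l : Fin p → ℝ)
    (v : Fin m → ℝ) :
    θ.kktSystem μ σ *ᵥ Sum.elim y (Sum.elim l v) =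
      Sum.elim (θ.Q *ᵥ y + (θ.Gᵀ *ᵥ l + θ.Aᵀ *ᵥ v))
        (Sum.elim (μ * (θ.G *ᵥ y) + σ * l) (θ.A *ᵥ y)) := by
  ext (i | i | i) <;>
    simp [kktSystem, Matrix.fromBlocks_mulVec,
      ← Matrix.mulVec_mulVec, Matrix.mulVec_diagonal, Matrix.fromRows_mulVec, Function.comp_def]

/-- The residual of the weighted KKT system with weights `μ`, as a linear function of the data. -/
def kktResidual (z : Fin n → ℝ) (lam : Fin p → ℝ) (nu : Fin m → ℝ) (μ : Fin p → ℝ) :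
    QPData n m p →ₗ[ℝ] (Fin n ⊕ (Fin p ⊕ Fin m) → ℝ) where
  toFun d := Sum.elim (-(d.Q *ᵥ z) - d.q - d.Gᵀ *ᵥ lam - d.Aᵀ *ᵥ nu)
    (Sum.elim (-(Matrix.diagonal μ *ᵥ (d.G *ᵥ z)) + Matrix.diagonal μ *ᵥ d.h)
      (-(d.A *ᵥ z) + d.b))
  map_add' d e := by
    have hQ : (d + e).Q = d.Q + e.Q := rfl
    have hq : (d + e).q = d.q + e.q := rfl
    have hA : (d + e).A = d.A + e.A := rfl
    have hb : (d + e).b = d.b + e.b := rfl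
    have hG : (d + e).G = d.G + e.G := rfl
    have hh : (d + e).h = d.h + e.h := rfl
    simp only [hQ, hq, hA, hb, hG, hh, Matrix.transpose_add, Matrix.add_mulVec, Matrix.mulVec_add]
    ext (i | i | i) <;> simp <;> ring
  map_smul' c d := by
    have hQ : (c • d).Q = c • d.Q := rfl
    have hq : (c • d).q = c • d.q := rfl
    have hA : (c • d).A = c • d.A := rfl
    have hb : (c • d).b = c • d.b := rfl
    have hG : (c • d).G = c • d.G := rfl
    have hh : (c • d).h = c • d.h := rfl
    simp only [hQ, hq, hA, hb, hG, hh, Matrix.transpose_smul, Matrix.smul_mulVec,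
      Matrix.mulVec_smul]
    ext (i | i | i) <;> simp <;> ring

theorem kktResidual_apply (z : Fin n → ℝ) (lam : Fin p → ℝ) (nu : Fin m → ℝ) (μ : Fin p → ℝ)
    (d : QPData n m p) :
    kktResidual z lam nu μ d = Sum.elim (-(d.Q *ᵥ z) - d.q - d.Gᵀ *ᵥ lam - d.Aᵀ *ᵥ nu)
      (Sum.elim (μ * (d.h - d.G *ᵥ z)) (d.b - d.A *ᵥ z)) := by
  ext (i | i | i)
  · rfl
  · simp only [kktResidual, LinearMap.coe_mk, AddHom.coe_mk, Sum.elim_inr, Sum.elim_inl,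
      Pi.add_apply, Pi.neg_apply, Matrix.mulVec_diagonal, Pi.mul_apply, Pi.sub_apply]
    ring
  · simp only [kktResidual, LinearMap.coe_mk, AddHom.coe_mk, Sum.elim_inr,
      Pi.add_apply, Pi.neg_apply, Pi.sub_apply]
    ring

/-- The derivative of the solution map predicted by the weighted KKT system. -/
noncomputable def kktJacobian (θ : QPData n m p) (z : Fin n → ℝ) (lam : Fin p → ℝ)
    (nu : Fin m → ℝ) (μ σ : Fin p → ℝ) : QPData n m p →L[ℝ] (Fin n → ℝ) :=
  LinearMap.toContinuousLinearMap
    (LinearMap.funLeft ℝ ℝ Sum.inl ∘ₗ (θ.kktSystem μ σ)⁻¹.mulVecLin ∘ₗ kktResidual z lam nu μ)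

theorem kktJacobian_apply (θ : QPData n m p) (z : Fin n → ℝ) (lam : Fin p → ℝ)
    (nu : Fin m → ℝ) (μ σ : Fin p → ℝ) (d : QPData n m p) :
    kktJacobian θ z lam nu μ σ d =
      fun i => ((θ.kktSystem μ σ)⁻¹ *ᵥ kktResidual z lam nu μ d) (Sum.inl i) := rfl

theorem contDiff_kktSystem (μ σ : Fin p → ℝ) (i j : Fin n ⊕ (Fin p ⊕ Fin m)) :
    ContDiff ℝ 1 (fun θ : QPData n m p => θ.kktSystem μ σ i j) := by
  have hQ : ∀ i j, ContDiff ℝ 1 (fun θ : QPData n m p => θ.Q i j) := fun i j =>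
    (LinearMap.toContinuousLinearMap (((LinearMap.proj j) ∘ₗ (LinearMap.proj i) ∘ₗ
      (symMatrices n).subtype) ∘ₗ LinearMap.fst ℝ _ _ : QPData n m p →ₗ[ℝ] ℝ)).contDiff
  have hA : ∀ i j, ContDiff ℝ 1 (fun θ : QPData n m p => θ.A i j) := fun i j => by
    change ContDiff ℝ 1 (fun θ : QPData n m p => θ.2.2.1 i j)
    fun_prop
  have hG : ∀ i j, ContDiff ℝ 1 (fun θ : QPData n m p => θ.G i j) := fun i j => by
    change ContDiff ℝ 1 (fun θ : QPData n m p => θ.2.2.2.2.1 i j)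
    fun_prop
  rcases i with i | i | i <;> rcases j with j | j | j <;>
    simp only [kktSystem, Matrix.fromBlocks_apply₁₁, Matrix.fromBlocks_apply₁₂,
      Matrix.fromBlocks_apply₂₁, Matrix.fromBlocks_apply₂₂, Matrix.fromCols_apply_inl,
      Matrix.fromCols_apply_inr, Matrix.fromRows_apply_inl, Matrix.fromRows_apply_inr,
      Matrix.diagonal_mul, Matrix.transpose_apply]
  all_goals first
    | exact hQ _ _ | exact hA _ _ | exact hG _ _ | exact contDiff_const.mul (hG _ _)
    | exact contDiff_const

theorem continuous_Q : Continuous (fun θ : QPData n m p => θ.Q) := by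
  change Continuous (fun θ : QPData n m p => (θ.1 : Fin n → Fin n → ℝ))
  fun_prop

theorem continuous_G : Continuous (fun θ : QPData n m p => θ.G) := by
  change Continuous (fun θ : QPData n m p => θ.2.2.2.2.1)
  fun_prop

theorem continuous_h : Continuous (fun θ : QPData n m p => θ.h) := by
  change Continuous (fun θ : QPData n m p => θ.2.2.2.2.2)
  fun_prop

theorem eventually_posDef {θ₀ : QPData n m p} (hQ : θ₀.Q.PosDef) :
    ∀ᶠ θ in 𝓝 θ₀, θ.Q.PosDef := by
  have h : ∀ᶠ θ in 𝓝 θ₀, ∀ x ∈ Metric.sphere (0 : Fin n → ℝ) 1, 0 < x ⬝ᵥ (θ.Q *ᵥ x) := by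
    refine (isCompact_sphere _ _).eventually_forall_of_forall_eventually fun x hx => ?_
    have hx0 : x ≠ 0 := by
      rintro rfl
      simp at hx
    refine ContinuousAt.eventually_lt (f := fun _ : QPData n m p × (Fin n → ℝ) => (0 : ℝ))
      (g := fun z => z.2 ⬝ᵥ (z.1.Q *ᵥ z.2)) continuousAt_const ?_ ?_
    · have := (continuous_Q (n := n) (m := m) (p := p)).comp
        (continuous_fst : Continuous (Prod.fst : QPData n m p × (Fin n → ℝ) → _))
      exact (continuous_snd.dotProduct (this.matrix_mulVec continuous_snd)).continuousAt
    · exact (posDef_iff θ₀).mp hQ x hx0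
  filter_upwards [h] with θ hθ
  refine (posDef_iff θ).mpr fun x hx => ?_
  have hn : 0 < ‖x‖ := norm_pos_iff.mpr hx
  have := hθ (‖x‖⁻¹ • x) (by simp [norm_smul, hn.ne'])
  rw [Matrix.mulVec_smul, dotProduct_smul, smul_dotProduct] at this
  simp only [smul_eq_mul] at this
  exact pos_of_mul_pos_right (pos_of_mul_pos_right this (by positivity)) (by positivity)

/-- Strict complementarity of `(z, lam)`, with weights `μ`, `σ` that single out the tight and the
slack constraints. -/
def StrictlyComplementary (θ : QPData n m p) (z : Fin n → ℝ) (lam μ σ : Fin p → ℝ) : Prop :=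
  ∀ i, (0 < lam i ∧ (θ.G *ᵥ z) i = θ.h i ∧ μ i ≠ 0 ∧ σ i = 0) ∨
    (lam i = 0 ∧ (θ.G *ᵥ z) i < θ.h i ∧ μ i = 0 ∧ σ i ≠ 0)

/-- The gradients of the constraints with nonzero weight, together with the equality constraints,
are linearly independent. -/
def IndependentGradients (θ : QPData n m p) (μ : Fin p → ℝ) : Prop :=
  ∀ l v, (∀ i, μ i = 0 → l i = 0) → θ.Gᵀ *ᵥ l + θ.Aᵀ *ᵥ v = 0 → l = 0 ∧ v = 0

/-- For a kernel vector `(y, l, v)`, `l` lives where `μ ≠ 0` and `G y` vanishes there, so pairing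
the first block row with `y` leaves `yᵀ Q y = 0`. Thus `y = 0`, and independence kills `l` and `v`.
-/
theorem IndependentGradients.det_ne_zero {θ : QPData n m p} (hQ : θ.Q.PosDef) {μ σ : Fin p → ℝ}
    (hi : θ.IndependentGradients μ)
    (hμσ : ∀ i, (μ i ≠ 0 ∧ σ i = 0) ∨ (μ i = 0 ∧ σ i ≠ 0)) : (θ.kktSystem μ σ).det ≠ 0 := by
  intro hdet
  obtain ⟨x, hx, hx0⟩ := Matrix.exists_mulVec_eq_zero_iff.mpr hdet
  obtain ⟨y, l, v, rfl⟩ : ∃ y l v, x = Sum.elim y (Sum.elim l v) :=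
    ⟨x ∘ Sum.inl, x ∘ Sum.inr ∘ Sum.inl, x ∘ Sum.inr ∘ Sum.inr, by ext (i | i | i) <;> rfl⟩
  rw [kktSystem_mulVec] at hx0
  have e1 : θ.Q *ᵥ y + (θ.Gᵀ *ᵥ l + θ.Aᵀ *ᵥ v) = 0 := by
    ext i
    exact congrFun hx0 (Sum.inl i)
  have e2 : ∀ i, μ i * (θ.G *ᵥ y) i + σ i * l i = 0 := fun i =>
    congrFun hx0 (Sum.inr (Sum.inl i))
  have e3 : θ.A *ᵥ y = 0 := by
    ext i
    exact congrFun hx0 (Sum.inr (Sum.inr i))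
  have hl : ∀ i, μ i = 0 → l i = 0 := by
    intro i hμ
    have := e2 i
    rcases hμσ i with h | h
    · exact absurd hμ h.1
    · simpa [hμ, h.2] using this
  have hgl : (θ.Gᵀ *ᵥ l) ⬝ᵥ y = 0 := by
    rw [Matrix.mulVec_transpose, ← Matrix.dotProduct_mulVec]
    refine Finset.sum_eq_zero fun i _ => ?_
    rcases hμσ i with h | h
    · have := e2 i
      rw [h.2] at this
      simp only [zero_mul, add_zero, mul_eq_zero, h.1, false_or] at this
      rw [this, mul_zero]
    · rw [hl i h.1, zero_mul]
  have hav : (θ.Aᵀ *ᵥ v) ⬝ᵥ y = 0 := by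
    rw [Matrix.mulVec_transpose, ← Matrix.dotProduct_mulVec, e3, dotProduct_zero]
  have hy : y = 0 := by
    by_contra hy
    have h1 := (posDef_iff θ).mp hQ y hy
    have h2 := congrArg (fun w => w ⬝ᵥ y) e1
    simp only [add_dotProduct, hgl, hav, zero_dotProduct, add_zero] at h2
    rw [dotProduct_comm] at h2
    linarith
  rw [hy, Matrix.mulVec_zero, zero_add] at e1
  obtain ⟨hl0, hv0⟩ := hi l v hl e1
  apply hx
  rw [hy, hl0, hv0]
  ext (i | i | i) <;> rfl

/-- The last block column is `(Aᵀ, 0, 0)`. Full row rank near `θ₀` thus follows from the openness of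
invertibility. -/
theorem rank_eq_of_det_ne_zero {θ : QPData n m p} {μ σ : Fin p → ℝ}
    (hdet : (θ.kktSystem μ σ).det ≠ 0) : θ.A.rank = m := by
  refine rank_eq_of_transpose_mulVec_eq_zero fun v hv => ?_
  have h : θ.kktSystem μ σ *ᵥ Sum.elim 0 (Sum.elim 0 v) = 0 := by
    rw [kktSystem_mulVec, hv]
    ext (i | i | i) <;> simp
  have := Matrix.eq_zero_of_mulVec_eq_zero hdet h
  ext i
  exact congrFun this (Sum.inr (Sum.inr i))

theorem IsKKT.kktResidual_eq_zero {θ : QPData n m p} {z : Fin n → ℝ} {lam : Fin p → ℝ}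
    {nu : Fin m → ℝ} (h : θ.IsKKT z lam nu) {μ : Fin p → ℝ}
    (hμ : ∀ i, μ i ≠ 0 → (θ.G *ᵥ z) i = θ.h i) : kktResidual z lam nu μ θ = 0 := by
  rw [kktResidual_apply]
  ext (i | i | i)
  · have := congrFun h.1 i
    simp only [Pi.add_apply, Pi.zero_apply, Sum.elim_inl, Pi.sub_apply, Pi.neg_apply] at this ⊢
    linarith
  · simp only [Sum.elim_inr, Sum.elim_inl, Pi.mul_apply, Pi.sub_apply, Pi.zero_apply]
    by_cases hi : μ i = 0
    · rw [hi, zero_mul]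
    · rw [hμ i hi, sub_self, mul_zero]
  · simp [h.2.1]

theorem contDiff_kktResidual (z : Fin n → ℝ) (lam : Fin p → ℝ) (nu : Fin m → ℝ) (μ : Fin p → ℝ)
    (j : Fin n ⊕ (Fin p ⊕ Fin m)) :
    ContDiff ℝ 1 (fun θ : QPData n m p => kktResidual z lam nu μ θ j) :=
  (LinearMap.toContinuousLinearMap ((LinearMap.proj j) ∘ₗ kktResidual z lam nu μ)).contDiff

theorem contDiffAt_kktSystem_inv_mulVec {θ₀ : QPData n m p} {μ σ : Fin p → ℝ}
    (hdet : (θ₀.kktSystem μ σ).det ≠ 0) (z : Fin n → ℝ) (lam : Fin p → ℝ) (nu : Fin m → ℝ) :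
    ContDiffAt ℝ 1
      (fun θ : QPData n m p => (θ.kktSystem μ σ)⁻¹ *ᵥ kktResidual z lam nu μ θ) θ₀ := by
  refine contDiffAt_pi.mpr fun i => ?_
  change ContDiffAt ℝ 1 (fun θ : QPData n m p =>
    ∑ j, (θ.kktSystem μ σ)⁻¹ i j * kktResidual z lam nu μ θ j) θ₀
  refine ContDiffAt.sum fun j _ => ?_
  exact (contDiffAt_matrix_inv (fun i j => (contDiff_kktSystem μ σ i j).contDiffAt) hdet i j).mul
    (contDiff_kktResidual z lam nu μ j).contDiffAt

theorem eventually_det_ne_zero {θ₀ : QPData n m p} {μ σ : Fin p → ℝ}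
    (hdet : (θ₀.kktSystem μ σ).det ≠ 0) : ∀ᶠ θ in 𝓝 θ₀, (θ.kktSystem μ σ).det ≠ 0 :=
  (contDiffAt_det (k := 1) (M := fun θ : QPData n m p => θ.kktSystem μ σ) fun i j =>
    (contDiff_kktSystem μ σ i j).contDiffAt).continuousAt.eventually_ne hdet

/-- Near strictly complementary data with invertible KKT system, the data stay admissible and the
solution is given by the linear system. -/
theorem IsKKT.eventually_zStar_eq {θ₀ : QPData n m p} (hQ : θ₀.Q.PosDef) {z : Fin n → ℝ}
    {lam : Fin p → ℝ} {nu : Fin m → ℝ} (h : θ₀.IsKKT z lam nu) {μ σ : Fin p → ℝ}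
    (hsc : θ₀.StrictlyComplementary z lam μ σ) (hdet : (θ₀.kktSystem μ σ).det ≠ 0) :
    ∀ᶠ θ in 𝓝 θ₀, θ ∈ admissible n m p ∧
      θ.zStar = fun i => z i + ((θ.kktSystem μ σ)⁻¹ *ᵥ kktResidual z lam nu μ θ) (Sum.inl i) := by
  -- `Y θ` is the correction that makes `(z, lam, nu) + Y θ` solve the linear system for the data
  -- `θ`.
  set Y : QPData n m p → (Fin n ⊕ (Fin p ⊕ Fin m) → ℝ) :=
    fun θ => (θ.kktSystem μ σ)⁻¹ *ᵥ kktResidual z lam nu μ θ with hY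
  have hYc : ContinuousAt Y θ₀ := (contDiffAt_kktSystem_inv_mulVec hdet z lam nu).continuousAt
  have hY0 : Y θ₀ = 0 := by
    simp only [hY]
    rw [h.kktResidual_eq_zero, Matrix.mulVec_zero]
    intro i hi
    rcases hsc i with h | h
    · exact h.2.1
    · exact absurd h.2.2.1 hi
  have hYi : ∀ j, ContinuousAt (fun θ => Y θ j) θ₀ := fun j =>
    (continuous_apply j).continuousAt.comp hYc
  -- The strict inequalities, positive multipliers and positive slacks, survive a small correction;
  -- the linear system takes care of the equalities.
  have hev : ∀ᶠ θ in 𝓝 θ₀, ∀ i,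
      (0 < lam i → 0 < lam i + Y θ (Sum.inr (Sum.inl i))) ∧
      ((θ₀.G *ᵥ z) i < θ₀.h i →
        (θ.G *ᵥ (fun k => z k + Y θ (Sum.inl k))) i < θ.h i) := by
    rw [eventually_all]
    intro i
    refine Filter.Eventually.and ?_ ?_
    · rw [eventually_imp_distrib_left]
      intro hi
      refine continuousAt_const.eventually_lt
        (g := fun θ => lam i + Y θ (Sum.inr (Sum.inl i))) (continuousAt_const.add (hYi _)) ?_
      simpa [hY0] using hi
    · rw [eventually_imp_distrib_left]
      intro hi
      have hc : ContinuousAt (fun θ : QPData n m p =>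
          (θ.G *ᵥ (fun k => z k + Y θ (Sum.inl k))) i) θ₀ := by
        change ContinuousAt (fun θ : QPData n m p => ∑ k, θ.G i k * (z k + Y θ (Sum.inl k))) θ₀
        refine tendsto_finsetSum _ fun k _ => ?_
        refine ContinuousAt.mul (f := fun θ : QPData n m p => θ.G i k)
          (g := fun θ => z k + Y θ (Sum.inl k)) ?_ (continuousAt_const.add (hYi _))
        exact ((continuous_apply k).comp ((continuous_apply i).comp continuous_G)).continuousAt
      refine hc.eventually_lt ((continuous_apply i).comp continuous_h).continuousAt ?_
      simpa [hY0] using hi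
  filter_upwards [eventually_posDef hQ, eventually_det_ne_zero hdet, hev] with θ hQθ hdetθ hθ
  have heq : θ.kktSystem μ σ *ᵥ Y θ = kktResidual z lam nu μ θ := by
    simp only [hY]
    rw [Matrix.mulVec_mulVec, Matrix.mul_nonsing_inv _ (isUnit_iff_ne_zero.mpr hdetθ),
      Matrix.one_mulVec]
  obtain ⟨y, l, v, hyl⟩ : ∃ y l v, Y θ = Sum.elim y (Sum.elim l v) :=
    ⟨Y θ ∘ Sum.inl, Y θ ∘ Sum.inr ∘ Sum.inl, Y θ ∘ Sum.inr ∘ Sum.inr, by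
      ext (i | i | i) <;> rfl⟩
  rw [hyl, kktSystem_mulVec, kktResidual_apply] at heq
  have hgoal : (fun i => z i + ((θ.kktSystem μ σ)⁻¹ *ᵥ kktResidual z lam nu μ θ) (Sum.inl i)) =
      z + y := by
    ext i
    exact congrArg (z i + ·) (congrFun hyl (Sum.inl i))
  rw [hgoal]
  simp only [hyl, Sum.elim_inl, Sum.elim_inr] at hθ
  have e1 : ∀ i, _ := fun i => congrFun heq (Sum.inl i)
  have e2 : ∀ i, _ := fun i => congrFun heq (Sum.inr (Sum.inl i))
  have e3 : ∀ i, _ := fun i => congrFun heq (Sum.inr (Sum.inr i))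
  simp only [Sum.elim_inl, Sum.elim_inr, Pi.add_apply, Pi.sub_apply, Pi.neg_apply,
    Pi.mul_apply] at e1 e2 e3
  have hzy : (fun k => z k + y k) = z + y := rfl
  rw [hzy] at hθ
  have hcases : ∀ i, (0 < lam i + l i ∧ (θ.G *ᵥ (z + y)) i = θ.h i) ∨
      (lam i + l i = 0 ∧ (θ.G *ᵥ (z + y)) i < θ.h i) := by
    intro i
    rcases hsc i with ⟨h1, h2, h3, h4⟩ | ⟨h1, h2, h3, h4⟩
    · refine Or.inl ⟨(hθ i).1 h1, ?_⟩
      have := e2 i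
      rw [h4, zero_mul, add_zero] at this
      have := mul_left_cancel₀ h3 this
      rw [Matrix.mulVec_add, Pi.add_apply, this]
      ring
    · refine Or.inr ⟨?_, (hθ i).2 h2⟩
      have := e2 i
      simpa [h3, h4, h1] using this
  have hk : θ.IsKKT (z + y) (lam + l) (nu + v) := by
    refine ⟨?_, ?_, ?_, ?_, ?_⟩
    · ext i
      have := e1 i
      simp only [Matrix.mulVec_add, Pi.add_apply, Pi.zero_apply]
      linarith
    · ext i
      have := e3 i
      simp only [Matrix.mulVec_add, Pi.add_apply]
      linarith
    · intro i
      rcases hcases i with h | h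
      · exact h.2.le
      · exact h.2.le
    · intro i
      rcases hcases i with h | h
      · exact h.1.le
      · exact h.1.ge
    · ext i
      rw [Matrix.mulVec_diagonal]
      simp only [Pi.add_apply, Pi.sub_apply, Pi.zero_apply]
      rcases hcases i with h | h
      · rw [h.2, sub_self, mul_zero]
      · rw [h.1, zero_mul]
  have hadm : θ ∈ admissible n m p :=
    ⟨hQθ, rank_eq_of_det_ne_zero hdetθ, z + y, hk.2.1, hk.2.2.1⟩
  exact ⟨hadm, hk.zStar_eq hadm⟩

theorem IsKKT.mem_interior_admissible {θ₀ : QPData n m p} (hQ : θ₀.Q.PosDef) {z : Fin n → ℝ}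
    {lam : Fin p → ℝ} {nu : Fin m → ℝ} (h : θ₀.IsKKT z lam nu) {μ σ : Fin p → ℝ}
    (hsc : θ₀.StrictlyComplementary z lam μ σ) (hdet : (θ₀.kktSystem μ σ).det ≠ 0) :
    θ₀ ∈ interior (admissible n m p) :=
  mem_interior_iff_mem_nhds.mpr ((h.eventually_zStar_eq hQ hsc hdet).mono fun _ h => h.1)

theorem IsKKT.contDiffAt_zStar {θ₀ : QPData n m p} (hQ : θ₀.Q.PosDef) {z : Fin n → ℝ}
    {lam : Fin p → ℝ} {nu : Fin m → ℝ} (h : θ₀.IsKKT z lam nu) {μ σ : Fin p → ℝ}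
    (hsc : θ₀.StrictlyComplementary z lam μ σ) (hdet : (θ₀.kktSystem μ σ).det ≠ 0) :
    ContDiffAt ℝ 1 (zStar : QPData n m p → _) θ₀ := by
  refine ContDiffAt.congr_of_eventuallyEq ?_
    ((h.eventually_zStar_eq hQ hsc hdet).mono fun _ h => h.2)
  refine contDiffAt_pi.mpr fun i => contDiffAt_const.add ?_
  exact contDiffAt_pi.mp (contDiffAt_kktSystem_inv_mulVec hdet z lam nu) _

theorem IsKKT.hasFDerivAt_zStar {θ₀ : QPData n m p} (hQ : θ₀.Q.PosDef) {z : Fin n → ℝ}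
    {lam : Fin p → ℝ} {nu : Fin m → ℝ} (h : θ₀.IsKKT z lam nu) {μ σ : Fin p → ℝ}
    (hsc : θ₀.StrictlyComplementary z lam μ σ) (hdet : (θ₀.kktSystem μ σ).det ≠ 0) :
    HasFDerivAt (zStar : QPData n m p → _) (kktJacobian θ₀ z lam nu μ σ) θ₀ := by
  refine HasFDerivAt.congr_of_eventuallyEq ?_
    ((h.eventually_zStar_eq hQ hsc hdet).mono fun _ h => h.2)
  refine hasFDerivAt_pi'' fun i => ?_
  refine HasFDerivAt.const_add _ ?_
  -- Since the residual vanishes at `θ₀`, the product rule loses the term containing the derivative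
  -- of the inverse.
  have hres : kktResidual z lam nu μ θ₀ = 0 := by
    refine h.kktResidual_eq_zero fun i hi => ?_
    rcases hsc i with h | h
    · exact h.2.1
    · exact absurd h.2.2.1 hi
  have hsum : HasFDerivAt
      (fun θ : QPData n m p => ∑ j, (θ.kktSystem μ σ)⁻¹ (Sum.inl i) j * kktResidual z lam nu μ θ j)
      (∑ j, (θ₀.kktSystem μ σ)⁻¹ (Sum.inl i) j • LinearMap.toContinuousLinearMap
        ((LinearMap.proj j) ∘ₗ kktResidual z lam nu μ)) θ₀ := by
    refine HasFDerivAt.fun_sum fun j _ => ?_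
    have h1 := ((contDiffAt_matrix_inv (fun i j => (contDiff_kktSystem μ σ i j).contDiffAt) hdet
      (Sum.inl i) j).differentiableAt one_ne_zero).hasFDerivAt
    have h2 := (LinearMap.toContinuousLinearMap
      ((LinearMap.proj j) ∘ₗ kktResidual (n := n) (m := m) (p := p) z lam nu μ)).hasFDerivAt
        (x := θ₀)
    refine (h1.mul h2).congr_fderiv ?_
    simp [hres]
  refine hsum.congr_fderiv ?_
  refine ContinuousLinearMap.ext fun d => ?_
  simp [kktJacobian_apply, Matrix.mulVec, dotProduct]

end QPData

/-! ### The Clarke subdifferential at a C¹ point. -/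

theorem clarkeSubdifferential_eq_singleton {E F : Type*} [NormedAddCommGroup E] [NormedSpace ℝ E]
    [NormedAddCommGroup F] [NormedSpace ℝ F] {U : Set E} {f : E → F} {x : E} {J : E →L[ℝ] F}
    (hx : x ∈ interior U) (hf : ContDiffAt ℝ 1 f x) (hJ : HasFDerivAt f J x) :
    clarkeSubdifferential U f x = {J} := by
  rw [clarkeSubdifferential]
  convert convexHull_singleton (𝕜 := ℝ) J
  refine Subset.antisymm ?_ ?_
  · rintro K ⟨u, -, hux, huK⟩
    have h := (hf.continuousAt_fderiv one_ne_zero).tendsto.comp hux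
    rw [hJ.fderiv] at h
    exact tendsto_nhds_unique huK h
  · rintro K rfl
    exact ⟨fun _ => x, fun _ => ⟨hx, hJ.differentiableAt⟩, tendsto_const_nhds,
      tendsto_const_nhds.congr fun _ => hJ.fderiv.symm⟩

/-! ### Multipliers with independent gradients, and nonemptiness of the subdifferential. -/

namespace QPData

variable {n m p : ℕ}

theorem IsKKT.tight {θ : QPData n m p} {z : Fin n → ℝ} {lam : Fin p → ℝ} {nu : Fin m → ℝ}
    (h : θ.IsKKT z lam nu) {i : Fin p} (hi : lam i ≠ 0) : (θ.G *ᵥ z) i = θ.h i :=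
  sub_eq_zero.mp ((mul_eq_zero.mp (h.complementary i)).resolve_left hi)

/-- If the gradients in the support of the multipliers are dependent, the multipliers can be changed
so that one more of them vanishes. -/
theorem IsKKT.exists_support_ssubset {θ : QPData n m p} (hA : θ.A.rank = m) {z : Fin n → ℝ}
    {lam : Fin p → ℝ} {nu : Fin m → ℝ} (h : θ.IsKKT z lam nu)
    (hdep : ¬ θ.IndependentGradients lam) :
    ∃ lam' nu', θ.IsKKT z lam' nu' ∧ (∀ i, lam i = 0 → lam' i = 0) ∧
      ∃ i, 0 < lam i ∧ lam' i = 0 := by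
  unfold IndependentGradients at hdep
  push Not at hdep
  obtain ⟨l, v, hl, hlv, hne⟩ := hdep
  have hl0 : l ≠ 0 := by
    rintro rfl
    rw [Matrix.mulVec_zero, zero_add] at hlv
    exact hne rfl (eq_zero_of_transpose_mulVec_eq_zero hA hlv)
  obtain ⟨t, hnn, i, hi, hit⟩ := exists_nonneg_add_smul_of_support_subset h.2.2.2.1 hl0 hl
  have hsupp : ∀ i, lam i = 0 → (lam + t • l) i = 0 := fun i hi => by simp [hi, hl i hi]
  refine ⟨lam + t • l, nu + t • v, ⟨?_, h.2.1, h.2.2.1, hnn, ?_⟩, hsupp, i, hi, hit⟩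
  · rw [Matrix.mulVec_add, Matrix.mulVec_add, Matrix.mulVec_smul, Matrix.mulVec_smul]
    calc _ = (θ.Q *ᵥ z + θ.q + θ.Aᵀ *ᵥ nu + θ.Gᵀ *ᵥ lam) + t • (θ.Gᵀ *ᵥ l + θ.Aᵀ *ᵥ v) := by
          rw [smul_add]
          abel
      _ = 0 := by rw [h.1, hlv, smul_zero, add_zero]
  · ext j
    rw [Matrix.mulVec_diagonal]
    by_cases hj : lam j = 0
    · rw [hsupp j hj, zero_mul, Pi.zero_apply]
    · rw [Pi.sub_apply, h.tight hj, sub_self, mul_zero, Pi.zero_apply]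

/-- Carathéodory-type reduction: the support shrinks strictly as long as its gradients are
dependent. -/
theorem IsKKT.exists_independentGradients {θ : QPData n m p} (hA : θ.A.rank = m)
    {z : Fin n → ℝ} {lam : Fin p → ℝ} {nu : Fin m → ℝ} (h : θ.IsKKT z lam nu) :
    ∃ lam' nu', θ.IsKKT z lam' nu' ∧ (∀ i, lam i = 0 → lam' i = 0) ∧
      θ.IndependentGradients lam' := by
  classical
  induction hk : (Finset.univ.filter fun i => lam i ≠ 0).card using Nat.strong_induction_on
    generalizing lam nu with
  | _ k ih =>
    by_cases hi : θ.IndependentGradients lam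
    · exact ⟨lam, nu, h, fun _ h => h, hi⟩
    · obtain ⟨l, v, hlv, hsub, i, hpos, hzero⟩ := h.exists_support_ssubset hA hi
      obtain ⟨l', v', h1, h2, h3⟩ := ih _ (by
        rw [← hk]
        refine Finset.card_lt_card (Finset.ssubset_iff_of_subset ?_ |>.mpr ⟨i, ?_, ?_⟩)
        · intro j hj
          simp only [Finset.mem_filter, Finset.mem_univ, true_and] at hj ⊢
          exact fun h => hj (hsub j h)
        · simpa using hpos.ne'
        · simpa using hzero) hlv rfl
      exact ⟨l', v', h1, fun j hj => h2 j (hsub j hj), h3⟩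

/-- Dependence would let some positive multiplier be moved to zero while its constraint stays tight,
a degenerate KKT point. -/
theorem IsKKT.independentGradients_of_notMem_degenerate {θ : QPData n m p}
    (hθ : θ ∈ admissible n m p) (hd : θ ∉ degenerate n m p) {z : Fin n → ℝ} {lam : Fin p → ℝ}
    {nu : Fin m → ℝ} (h : θ.IsKKT z lam nu) : θ.IndependentGradients lam := by
  by_contra hdep
  obtain ⟨l, v, hlv, -, i, hpos, hzero⟩ := h.exists_support_ssubset hθ.2.1 hdep
  exact hd ⟨hθ, z, l, v, hlv, i, hzero, sub_eq_zero.mpr (h.tight hpos.ne')⟩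

theorem IsKKT.strictlyComplementary_of_notMem_degenerate {θ : QPData n m p}
    (hθ : θ ∈ admissible n m p) (hd : θ ∉ degenerate n m p) {z : Fin n → ℝ} {lam : Fin p → ℝ}
    {nu : Fin m → ℝ} (h : θ.IsKKT z lam nu) :
    θ.StrictlyComplementary z lam lam (θ.G *ᵥ z - θ.h) := by
  intro i
  by_cases hi : lam i = 0
  · have hne : (θ.G *ᵥ z - θ.h) i ≠ 0 := fun h0 => hd ⟨hθ, z, lam, nu, h, i, hi, h0⟩
    exact Or.inr ⟨hi, lt_of_le_of_ne (h.2.2.1 i) (sub_ne_zero.mp hne), hi, hne⟩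
  · exact Or.inl ⟨lt_of_le_of_ne (h.2.2.2.1 i) (Ne.symm hi), h.tight hi, hi,
      sub_eq_zero.mpr (h.tight hi)⟩

theorem StrictlyComplementary.weights {θ : QPData n m p} {z : Fin n → ℝ} {lam μ σ : Fin p → ℝ}
    (h : θ.StrictlyComplementary z lam μ σ) (i : Fin p) :
    (μ i ≠ 0 ∧ σ i = 0) ∨ (μ i = 0 ∧ σ i ≠ 0) :=
  (h i).imp (fun h => h.2.2) fun h => h.2.2

/-- The right-hand side is `(-q, μ * h, b)`, free of `(z, lam, nu)`: when the matrix is invertible,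
the KKT point becomes a function of the data and the weights alone. -/
theorem IsKKT.kktSystem_mulVec_eq {θ : QPData n m p} {z : Fin n → ℝ} {lam : Fin p → ℝ}
    {nu : Fin m → ℝ} (h : θ.IsKKT z lam nu) {μ σ : Fin p → ℝ}
    (hμ : ∀ i, μ i ≠ 0 → (θ.G *ᵥ z) i = θ.h i) (hσ : ∀ i, σ i * lam i = 0) :
    θ.kktSystem μ σ *ᵥ Sum.elim z (Sum.elim lam nu) = kktResidual 0 0 0 μ θ := by
  rw [kktSystem_mulVec, kktResidual_apply]
  ext (i | i | i)
  · have := congrFun h.1 i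
    simp only [Pi.add_apply, Pi.zero_apply, Sum.elim_inl, Pi.sub_apply, Pi.neg_apply,
      Matrix.mulVec_zero] at this ⊢
    linarith
  · simp only [Sum.elim_inr, Sum.elim_inl, Pi.mul_apply, Pi.add_apply, hσ, Matrix.mulVec_zero,
      sub_zero, add_zero]
    by_cases hi : μ i = 0
    · rw [hi, zero_mul, zero_mul]
    · rw [hμ i hi]
  · simp [h.2.1]

theorem clarkeSubdifferential_nonempty {θ : QPData n m p} (hθ : θ ∈ admissible n m p) :
    (clarkeSubdifferential (admissible n m p) zStar θ).Nonempty := by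
  classical
  obtain ⟨l₀, v₀, h₀⟩ := (isSolution_zStar hθ).exists_isKKT
  obtain ⟨lam, nu, h, -, hind⟩ := h₀.exists_independentGradients hθ.2.1
  set z := θ.zStar
  -- `s` serves both as the direction in which `h` is relaxed and as the weight `σ` of the slack
  -- rows.
  let s : Fin p → ℝ := fun i => if lam i = 0 then 1 else 0
  let e : QPData n m p := (0, 0, 0, 0, 0, s)
  let u : ℕ → QPData n m p := fun k => θ + (1 / ((k : ℝ) + 1)) • e
  have hQ : ∀ k, (u k).Q = θ.Q := fun k => by
    change θ.Q + (1 / ((k : ℝ) + 1)) • e.Q = θ.Q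
    rw [show e.Q = 0 from rfl, smul_zero, add_zero]
  have hq : ∀ k, (u k).q = θ.q := fun k => by
    change θ.q + (1 / ((k : ℝ) + 1)) • e.q = θ.q
    rw [show e.q = 0 from rfl, smul_zero, add_zero]
  have hA : ∀ k, (u k).A = θ.A := fun k => by
    change θ.A + (1 / ((k : ℝ) + 1)) • e.A = θ.A
    rw [show e.A = 0 from rfl, smul_zero, add_zero]
  have hb : ∀ k, (u k).b = θ.b := fun k => by
    change θ.b + (1 / ((k : ℝ) + 1)) • e.b = θ.b
    rw [show e.b = 0 from rfl, smul_zero, add_zero]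
  have hG : ∀ k, (u k).G = θ.G := fun k => by
    change θ.G + (1 / ((k : ℝ) + 1)) • e.G = θ.G
    rw [show e.G = 0 from rfl, smul_zero, add_zero]
  have hh : ∀ k i, (u k).h i = θ.h i + (1 / ((k : ℝ) + 1)) * s i := fun k i => rfl
  have hle : ∀ k, θ.h ≤ (u k).h := fun k i => by
    rw [hh]
    have : 0 ≤ s i := by
      simp only [s]
      split_ifs <;> norm_num
    have : 0 ≤ 1 / ((k : ℝ) + 1) * s i := by positivity
    linarith
  have hsc : ∀ k, (u k).StrictlyComplementary z lam lam s := by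
    intro k i
    by_cases hi : lam i = 0
    · refine Or.inr ⟨hi, ?_, hi, by simp [s, hi]⟩
      rw [hG, hh]
      have : 0 < 1 / ((k : ℝ) + 1) * s i := by
        simp only [s, hi, if_true]
        positivity
      have := h.2.2.1 i
      linarith
    · refine Or.inl ⟨lt_of_le_of_ne (h.2.2.2.1 i) (Ne.symm hi), ?_, hi, by simp [s, hi]⟩
      rw [hG, hh, h.tight hi]
      simp [s, hi]
  have hK : ∀ k, (u k).IsKKT z lam nu := by
    intro k
    refine ⟨by rw [hQ, hq, hA, hG]; exact h.1, by rw [hA, hb]; exact h.2.1,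
      by rw [hG]; exact h.2.2.1.trans (hle k), h.2.2.2.1, ?_⟩
    ext i
    rw [Matrix.mulVec_diagonal, Pi.sub_apply, Pi.zero_apply]
    rcases hsc k i with h | h
    · rw [h.2.1, sub_self, mul_zero]
    · rw [h.1, zero_mul]
  have hN : ∀ k, (u k).kktSystem lam s = θ.kktSystem lam s := fun k => by
    simp only [kktSystem, hQ, hA, hG]
  have hdet : ∀ k, ((u k).kktSystem lam s).det ≠ 0 := fun k => by
    rw [hN]
    exact hind.det_ne_zero hθ.1 (hsc 0).weights
  have hQ' : ∀ k, (u k).Q.PosDef := fun k => by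
    rw [hQ]
    exact hθ.1
  -- Neither the matrix nor the KKT point changes with `k`, so the sequence of derivatives is
  -- constant.
  have hder : ∀ k, HasFDerivAt zStar (kktJacobian θ z lam nu lam s) (u k) := fun k => by
    have := (hK k).hasFDerivAt_zStar (hQ' k) (hsc k) (hdet k)
    rwa [kktJacobian, hN] at this
  refine ⟨kktJacobian θ z lam nu lam s, subset_convexHull ℝ _ ⟨u, fun k =>
    ⟨(hK k).mem_interior_admissible (hQ' k) (hsc k) (hdet k), (hder k).differentiableAt⟩, ?_, ?_⟩⟩
  · have : Tendsto (fun k : ℕ => θ + (1 / ((k : ℝ) + 1)) • e) atTop (𝓝 (θ + (0 : ℝ) • e)) :=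
      tendsto_const_nhds.add (tendsto_one_div_add_atTop_nhds_zero_nat.smul_const e)
    rwa [zero_smul, add_zero] at this
  · simp only [fun k => (hder k).fderiv]
    exact tendsto_const_nhds

/-! ### Degenerate data form a null set. -/

/-- The data for which the solution of the weighted KKT system is tight at the `i`-th
constraint. -/
def tightSet (n m : ℕ) {p : ℕ} (μ σ : Fin p → ℝ) (i : Fin p) : Set (QPData n m p) :=
  {θ | θ.h i = ∑ j, θ.G i j * ∑ k, (θ.kktSystem μ σ)⁻¹ (Sum.inl j) k * kktResidual 0 0 0 μ θ k}

instance : BorelSpace (QPData n m p) :=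
  Prod.borelSpace

theorem measurableSet_tightSet (μ σ : Fin p → ℝ) (i : Fin p) :
    MeasurableSet (tightSet n m μ σ i) := by
  have hN : Continuous fun θ : QPData n m p => θ.kktSystem μ σ :=
    continuous_matrix fun i j => (contDiff_kktSystem μ σ i j).continuous
  refine measurableSet_eq_fun ((continuous_apply i).comp continuous_h).measurable ?_
  refine Finset.measurable_fun_sum _ fun j _ => Measurable.mul ?_ ?_
  · exact ((continuous_apply j).comp ((continuous_apply i).comp continuous_G)).measurable
  refine Finset.measurable_fun_sum _ fun k _ => Measurable.mul ?_ ?_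
  -- Where the determinant vanishes the inverse is zero by convention, so the formula is measurable
  -- everywhere although not continuous.
  · simp only [Matrix.inv_def, Ring.inverse_eq_inv, Matrix.smul_apply, smul_eq_mul]
    exact hN.matrix_det.measurable.inv.mul (hN.matrix_adjugate.matrix_elem _ _).measurable
  · exact (contDiff_kktResidual 0 0 0 μ k).continuous.measurable

/-- As `μ i = 0`, the entry `h i` occurs only on the left of the defining equation, so the set is a
graph over the other coordinates. Its translates by distinct multiples of the `h i` direction are
disjoint, and infinitely many bounded translates can be disjoint only for a null set. -/
theorem measure_tightSet (ν : Measure (QPData n m p)) [ν.IsAddHaarMeasure] {μ σ : Fin p → ℝ}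
    {i : Fin p} (hi : μ i = 0) : ν (tightSet n m μ σ i) = 0 := by
  let e : QPData n m p := (0, 0, 0, 0, 0, Pi.single i 1)
  have hlim : Tendsto (fun k : ℕ => (1 / ((k : ℝ) + 1)) • e) atTop (𝓝 ((0 : ℝ) • e)) :=
    tendsto_one_div_add_atTop_nhds_zero_nat.smul_const e
  refine Measure.addHaar_eq_zero_of_disjoint_translates ν (fun k : ℕ => (1 / ((k : ℝ) + 1)) • e)
    (Metric.isBounded_range_of_tendsto _ hlim) ?_ (measurableSet_tightSet μ σ i)
  have hshift : ∀ (t : ℝ) (θ : QPData n m p), θ ∈ tightSet n m μ σ i →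
      (t • e + θ).h i = t + ∑ j, (t • e + θ).G i j *
        ∑ k, ((t • e + θ).kktSystem μ σ)⁻¹ (Sum.inl j) k * kktResidual 0 0 0 μ (t • e + θ) k := by
    intro t θ hθ
    have hQ : (t • e + θ).Q = θ.Q := by
      change t • e.Q + θ.Q = θ.Q
      rw [show e.Q = 0 from rfl, smul_zero, zero_add]
    have hA : (t • e + θ).A = θ.A := by
      change t • e.A + θ.A = θ.A
      rw [show e.A = 0 from rfl, smul_zero, zero_add]
    have hG : (t • e + θ).G = θ.G := by
      change t • e.G + θ.G = θ.G
      rw [show e.G = 0 from rfl, smul_zero, zero_add]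
    have hh : (t • e + θ).h i = t + θ.h i := by
      change t * (Pi.single i 1 : Fin p → ℝ) i + θ.h i = _
      simp
    have hr : kktResidual 0 0 0 μ (t • e + θ) = kktResidual 0 0 0 μ θ := by
      rw [map_add, map_smul]
      have : kktResidual 0 0 0 μ e = 0 := by
        rw [kktResidual_apply]
        ext (j | j | j)
        · simp [e, q]
        · by_cases hj : j = i
          · simp [hj, hi]
          · simp [e, h, hj]
        · simp [e, b]
      rw [this, smul_zero, zero_add]
    have hN : (t • e + θ).kktSystem μ σ = θ.kktSystem μ σ := by
      simp only [kktSystem, hQ, hA, hG]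
    rw [hG, hr, hN, hh, hθ.out]
  intro a c hac
  refine Set.disjoint_left.mpr fun x hx hx' => hac ?_
  simp only [Set.singleton_add, Set.mem_image] at hx hx'
  obtain ⟨θ, hθ, rfl⟩ := hx
  obtain ⟨θ', hθ', heq⟩ := hx'
  have h1 := hshift (1 / ((a : ℝ) + 1)) θ hθ
  have h2 := hshift (1 / ((c : ℝ) + 1)) θ' hθ'
  rw [heq, h1] at h2
  have h3 : 1 / ((a : ℝ) + 1) = 1 / ((c : ℝ) + 1) := add_right_cancel h2
  rw [one_div, one_div, _root_.inv_inj] at h3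
  exact_mod_cast add_right_cancel h3

theorem measure_degenerate (ν : Measure (QPData n m p)) [ν.IsAddHaarMeasure] :
    ν (degenerate n m p) = 0 := by
  classical
  -- Weights that are indicators, independent of the data, reduce the covering to finitely many
  -- sets.
  let μ : Finset (Fin p) → Fin p → ℝ := fun B i => if i ∈ B then 1 else 0
  let σ : Finset (Fin p) → Fin p → ℝ := fun B i => if i ∈ B then 0 else 1
  have hsub : degenerate n m p ⊆ ⋃ (B : Finset (Fin p)) (i : Fin p) (_ : i ∉ B),
      tightSet n m (μ B) (σ B) i := by
    rintro θ ⟨hθ, z, l₀, v₀, h₀, i, hi, hti⟩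
    -- The reduction only shrinks the support, so the tight constraint `i` keeps a zero multiplier
    -- and stays outside `B`.
    obtain ⟨lam, nu, h, hsupp, hind⟩ := h₀.exists_independentGradients hθ.2.1
    let B := Finset.univ.filter fun j => lam j ≠ 0
    have hB : ∀ j, j ∈ B ↔ lam j ≠ 0 := fun j => by simp [B]
    have hiB : i ∉ B := fun h => (hB i).mp h (hsupp i hi)
    simp only [Set.mem_iUnion]
    refine ⟨B, i, hiB, ?_⟩
    have hind' : θ.IndependentGradients (μ B) := by
      intro l v hl
      refine hind l v fun j hj => hl j ?_
      simp [μ, hB, hj]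
    have hdet : (θ.kktSystem (μ B) (σ B)).det ≠ 0 := by
      refine hind'.det_ne_zero hθ.1 fun j => ?_
      by_cases hj : j ∈ B <;> simp [μ, σ, hj]
    have heq := h.kktSystem_mulVec_eq (μ := μ B) (σ := σ B)
      (fun j hj => h.tight ((hB j).mp (by by_contra h; exact hj (by simp [μ, h]))))
      (fun j => by
        by_cases hj : j ∈ B
        · simp [σ, hj]
        · simp [not_not.mp (mt (hB j).mpr hj)])
    have hinv : (θ.kktSystem (μ B) (σ B))⁻¹ *ᵥ kktResidual 0 0 0 (μ B) θ =
        Sum.elim z (Sum.elim lam nu) := by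
      rw [← heq, Matrix.mulVec_mulVec, Matrix.nonsing_inv_mul _ (isUnit_iff_ne_zero.mpr hdet),
        Matrix.one_mulVec]
    change θ.h i = ∑ j, θ.G i j *
      ((θ.kktSystem (μ B) (σ B))⁻¹ *ᵥ kktResidual 0 0 0 (μ B) θ) (Sum.inl j)
    rw [hinv]
    exact (sub_eq_zero.mp hti).symm
  refine measure_mono_null hsub ?_
  simp only [measure_iUnion_null_iff]
  exact fun B i hi => measure_tightSet ν (by simp [μ, hi])

end QPData

theorem theorem1 (n m p : ℕ) :
    (∀ θ ∈ QPData.admissible n m p, θ.IsSolution θ.zStar ∧ ∀ z, θ.IsSolution z → z = θ.zStar) ∧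
    (∀ θ ∈ QPData.admissible n m p,
      (clarkeSubdifferential (QPData.admissible n m p) QPData.zStar θ).Nonempty) ∧
    (∀ μ : Measure (QPData n m p), μ.IsAddHaarMeasure → μ (QPData.degenerate n m p) = 0) ∧
    (∀ θ ∈ QPData.admissible n m p, θ ∉ QPData.degenerate n m p →
      θ ∈ interior (QPData.admissible n m p) ∧
      ∃ J : QPData n m p →L[ℝ] (Fin n → ℝ),
        HasFDerivAt QPData.zStar J θ ∧
        clarkeSubdifferential (QPData.admissible n m p) QPData.zStar θ = {J} ∧
        (∃ lam nu, θ.IsKKT θ.zStar lam nu) ∧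
        ∀ lam nu, θ.IsKKT θ.zStar lam nu →
          IsUnit (QPData.kktMatrix θ θ.zStar lam).det ∧
          ∀ d : QPData n m p, J d = fun i =>
            ((QPData.kktMatrix θ θ.zStar lam)⁻¹ *ᵥ QPData.kktRhs θ.zStar lam nu d) (Sum.inl i)) := by
  refine ⟨fun θ hθ => ⟨QPData.isSolution_zStar hθ, fun z hz =>
    (QPData.isSolution_zStar hθ).unique hθ.1 hz⟩,
    fun θ hθ => QPData.clarkeSubdifferential_nonempty hθ,
    fun μ _ => QPData.measure_degenerate μ, fun θ hθ hd => ?_⟩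
  have hdet : ∀ lam nu, θ.IsKKT θ.zStar lam nu →
      (θ.kktSystem lam (θ.G *ᵥ θ.zStar - θ.h)).det ≠ 0 := fun lam nu h =>
    (h.independentGradients_of_notMem_degenerate hθ hd).det_ne_zero hθ.1
      (h.strictlyComplementary_of_notMem_degenerate hθ hd).weights
  have hder := fun lam nu (h : θ.IsKKT θ.zStar lam nu) => h.hasFDerivAt_zStar hθ.1
    (h.strictlyComplementary_of_notMem_degenerate hθ hd) (hdet lam nu h)
  obtain ⟨lam, nu, h⟩ := (QPData.isSolution_zStar hθ).exists_isKKT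
  have hsc := h.strictlyComplementary_of_notMem_degenerate hθ hd
  have hint := h.mem_interior_admissible hθ.1 hsc (hdet lam nu h)
  refine ⟨hint, _, hder lam nu h, clarkeSubdifferential_eq_singleton hint
    (h.contDiffAt_zStar hθ.1 hsc (hdet lam nu h)) (hder lam nu h), ⟨lam, nu, h⟩,
    fun l v hlv => ⟨isUnit_iff_ne_zero.mpr (hdet l v hlv), fun d => ?_⟩⟩
  -- Uniqueness of the derivative makes the formula independent of the multipliers chosen.
  rw [(hder lam nu h).unique (hder l v hlv)]
  rfl
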